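/- Let $\tfrac12<\alpha<\tfrac32$, $\lambda>0$, $H=\alpha-\tfrac12\in(0,1)$, let $\eta$ be Gaussian white noise on $\mathbb R$, and let $$X_{\alpha,\lambda}(t)=\frac1{\Gamma(\alpha)}\int_{-\infty}^t e^{-\lambda(t-u)}(t-u)^{\alpha-1}\,\eta(u)\,du,\qquad B_{\alpha,\lambda}(t)=X_{\alpha,\lambda}(t)-X_{\alpha,\lambda}(0)\qquad(t\in\mathbb R)$$ be the fractional Ornstein–Uhlenbeck process (FOU) and tempered fractional Brownian motion (TFBM). Put $$A=-\frac{1}{2\,\Gamma(2\alpha)\cos(\alpha\pi)} .$$ Let $C(\tau)=\frac{1}{\sqrt\pi\,\Gamma(\alpha)}\bigl(\frac{|\tau|}{2\lambda}\bigr)^{\alpha-1/2}K_{\alpha-1/2}(\lambda|\tau|)$ for $\tau\ne0$, where $K_\nu$ is the modified Bessel function of the second kind, let $C(0)=\frac{\Gamma(2\alpha-1)}{\Gamma(\alpha)^2(2\lambda)^{2\alpha-1}}$, and let $\breve C(t,s)=C(t-s)-C(t)-C(s)+C(0)$. 1. For all $t,s\in\mathbb R$, $\mathbb E[X_{\alpha,\lambda}(t)X_{\alpha,\lambda}(s)]=C(t-s)$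 and $\mathbb E[B_{\alpha,\lambda}(t)B_{\alpha,\lambda}(s)]=\breve C(t,s)$. 2. $A>0$, and if $H\neq\frac12$ then $A=\dfrac{\Gamma(1-2H)\cos(H\pi)}{2H\pi}$. 3. (Local self-similarity.) With $\kappa=2H=2\alpha-1\in(0,2)$: as $|\tau|\to0$, $C(\tau)=C(0)-A|\tau|^{\kappa}(1+o(1))$, and for every fixed $t\in\mathbb R$ $$\breve C(t,t+\tau)=\tfrac12\bigl(\breve C(t,t)+\breve C(t+\tau,t+\tau)\bigr)-A|\tau|^{\kappa}(1+o(1)).$$ Moreover, as $(t,\tau)\to(0,0)$, $$\breve C(t,t+\tau)=A\bigl(|t+\tau|^{2H}+|t|^{2H}-|\tau|^{2H}\bigr)+o\bigl(|t|^{2H}+|\tau|^{2H}\bigr),$$ $$\tfrac12\bigl(\breve C(t+\tau,t+\tau)+\breve C(t,t)\bigr)=A\bigl(|t+\tau|^{2H}+|t|^{2H}\bigr)+o\bigl(|t|^{2H}+|\tau|^{2H}\bigr).$$ 4. (Tangent process.) There is a fractional Brownian motion $T=(T(u))_{u\in\mathbb R}$ with Hurst index $H=\alpha-\frac12$, namely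 a centred Gaussian process with covariance $A\bigl(|u|^{2H}+|v|^{2H}-|u-v|^{2H}\bigr)$, such that for $Z=X_{\alpha,\lambda}$ and for $Z=B_{\alpha,\lambda}$, and for every $t_0\in\mathbb R$, the finite-dimensional distributions of $$u\mapsto\frac{Z(t_0+\varepsilon u)-Z(t_0)}{\varepsilon^{H}}$$ converge weakly, as $\varepsilon\to0^+$, to those of $T$, which is non-degenerate. -/

import Mathlib

open MeasureTheory ProbabilityTheory Filter Topology Asymptotics

/-- The modified Bessel function of the second kind `K_ν(z)`, for real `ν` and `z > 0`:
`K_ν(z) = ∫_0^∞ exp (-z cosh s) cosh (ν s) ds`. -/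
noncomputable def besselK (ν z : ℝ) : ℝ :=
  ∫ s in Set.Ioi (0 : ℝ), Real.exp (-z * Real.cosh s) * Real.cosh (ν * s)

/-- Gaussian white noise on `ℝ`, given by its action `f ↦ ∫ f(u) η(u) du` on `L²(ℝ)`:
a centred Gaussian family with covariance `E[W f * W g] = ∫ f g`. -/
structure IsWhiteNoise {Ω : Type*} [MeasurableSpace Ω]
    (W : Lp ℝ 2 (volume : Measure ℝ) → Ω → ℝ) (P : Measure Ω) : Prop where
  gaussian : IsGaussianProcess W P
  centred : ∀ f, ∫ ω, W f ω ∂P = 0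
  covariance : ∀ f g, ∫ ω, W f ω * W g ω ∂P = inner ℝ f g

open Classical in
/-- The Wiener integral `∫ f(u) η(u) du` of a function `f ∈ L²(ℝ)` (and `0` if `f ∉ L²(ℝ)`). -/
noncomputable def wienerIntegral {Ω : Type*} (W : Lp ℝ 2 (volume : Measure ℝ) → Ω → ℝ)
    (f : ℝ → ℝ) : Ω → ℝ :=
  if h : MemLp f 2 (volume : Measure ℝ) then W (h.toLp f) else 0

/-- The moving average kernel `exp (-λ (t-u)) (t-u)^(α-1) / Γ(α)`, `u < t`. -/
noncomputable def fouKernel (α lam t u : ℝ) : ℝ :=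
  if u < t then Real.exp (-lam * (t - u)) * (t - u) ^ (α - 1) / Real.Gamma α else 0

/-- The kernel is square integrable for `α > 1/2`, `λ > 0`, so that the Wiener integral below is
never the default value. -/
theorem memLp_fouKernel {α lam : ℝ} (hα : 1 / 2 < α) (hlam : 0 < lam) (t : ℝ) :
    MemLp (fouKernel α lam t) 2 (volume : Measure ℝ) := by
  have hm : Measurable (fouKernel α lam t) := by
    unfold fouKernel
    refine Measurable.ite measurableSet_Iio ?_ measurable_const
    fun_prop
  rw [memLp_two_iff_integrable_sq hm.aestronglyMeasurable]
  have h0 := integrableOn_rpow_mul_exp_neg_mul_rpow (p := 1) (s := 2 * α - 2) (b := 2 * lam)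
    (by linarith) one_pos (by linarith)
  rw [← integrable_indicator_iff measurableSet_Ioi] at h0
  have h1 := (h0.comp_sub_left t).const_mul ((Real.Gamma α ^ 2)⁻¹)
  refine h1.congr (Eventually.of_forall fun u => ?_)
  by_cases hu : u < t
  · have hp : 0 < t - u := sub_pos.2 hu
    have e1 : Real.exp (-(2 * lam) * (t - u)) = Real.exp (-lam * (t - u)) ^ 2 := by
      rw [← Real.exp_nat_mul]; congr 1; push_cast; ring
    have e2 : (t - u) ^ (2 * α - 2) = ((t - u) ^ (α - 1)) ^ 2 := by
      rw [← Real.rpow_natCast, ← Real.rpow_mul hp.le]; congr 1; push_cast; ring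
    simp only [fouKernel, hu, if_true, Set.indicator, Set.mem_Ioi, hp, Real.rpow_one, e1, e2]
    ring
  · simp [fouKernel, hu, Set.indicator]

/-- The fractional Ornstein-Uhlenbeck process (FOU) of Weyl type,
`X(t) = Γ(α)⁻¹ ∫_{-∞}^t exp (-λ (t-u)) (t-u)^(α-1) η(u) du`. -/
noncomputable def fou {Ω : Type*} (W : Lp ℝ 2 (volume : Measure ℝ) → Ω → ℝ) (α lam : ℝ)
    (t : ℝ) : Ω → ℝ :=
  wienerIntegral W (fouKernel α lam t)

/-- Tempered fractional Brownian motion (TFBM), i.e. the reduced FOU `B(t) = X(t) - X(0)`. -/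
noncomputable def tfbm {Ω : Type*} (W : Lp ℝ 2 (volume : Measure ℝ) → Ω → ℝ) (α lam : ℝ)
    (t : ℝ) (ω : Ω) : ℝ :=
  fou W α lam t ω - fou W α lam 0 ω

/-- The covariance function of FOU in closed form, with the variance as its value at `τ = 0`. -/
noncomputable def fouCov (α lam τ : ℝ) : ℝ :=
  if τ = 0 then Real.Gamma (2 * α - 1) / (Real.Gamma α ^ 2 * (2 * lam) ^ (2 * α - 1))
  else 1 / (√Real.pi * Real.Gamma α) * (|τ| / (2 * lam)) ^ (α - 1 / 2)
    * besselK (α - 1 / 2) (lam * |τ|)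

/-- The covariance function of TFBM in closed form. -/
noncomputable def tfbmCov (α lam t s : ℝ) : ℝ :=
  fouCov α lam (t - s) - fouCov α lam t - fouCov α lam s + fouCov α lam 0

/-- Local self-similarity of order `κ` with constant `A` of a stationary covariance:
`C(τ) = C(0) - A |τ|^κ (1 + o(1))` as `|τ| → 0`, where `0 < κ < 2` and `A > 0`. -/
def IsLocallySelfSimilarStationary (C : ℝ → ℝ) (κ A : ℝ) : Prop :=
  0 < κ ∧ κ < 2 ∧ 0 < A ∧
    (fun τ : ℝ => C τ - (C 0 - A * |τ| ^ κ)) =o[𝓝 0] fun τ : ℝ => |τ| ^ κ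

/-- Local self-similarity of order `κ` with constant `A` of a not necessarily stationary
covariance: at every `t`, as `|τ| → 0`,
`C(t,t+τ) = (C(t,t) + C(t+τ,t+τ)) / 2 - A |τ|^κ (1 + o(1))`, where `0 < κ < 2` and `A > 0`. -/
def IsLocallySelfSimilar (C : ℝ → ℝ → ℝ) (κ A : ℝ) : Prop :=
  0 < κ ∧ κ < 2 ∧ 0 < A ∧ ∀ t : ℝ,
    (fun τ : ℝ => C t (t + τ) - ((C t t + C (t + τ) (t + τ)) / 2 - A * |τ| ^ κ))
      =o[𝓝 0] fun τ : ℝ => |τ| ^ κ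

/-- Fractional Brownian motion on `ℝ` with Hurst index `H` and variance `V` at time `1`. -/
structure IsFBM {Ω : Type*} [MeasurableSpace Ω] (H V : ℝ) (B : ℝ → Ω → ℝ) (P : Measure Ω) :
    Prop where
  gaussian : IsGaussianProcess B P
  centred : ∀ t, ∫ ω, B t ω ∂P = 0
  covariance : ∀ t s, ∫ ω, B t ω * B s ω ∂P
    = V / 2 * (|t| ^ (2 * H) + |s| ^ (2 * H) - |t - s| ^ (2 * H))

/-- `T` is a non-degenerate tangent process of order `κ` of `Z` at the point `t₀`: as `ε → 0+`, the
finite dimensional distributions of `u ↦ (Z(t₀ + ε u) - Z(t₀)) / ε^κ` converge weakly to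
those of `T`. -/
structure IsTangentProcess {Ω Ω' : Type*} [MeasurableSpace Ω] [MeasurableSpace Ω']
    (Z : ℝ → Ω → ℝ) (P : Measure Ω) [IsProbabilityMeasure P] (κ t₀ : ℝ)
    (T : ℝ → Ω' → ℝ) (P' : Measure Ω') [IsProbabilityMeasure P'] : Prop where
  nondegenerate : ∃ u, ¬ (T u =ᵐ[P'] 0)
  tendsto : ∀ I : Finset ℝ,
    TendstoInDistribution
      (fun (ε : ℝ) (ω : Ω) => I.restrict fun u : ℝ => (Z (t₀ + ε * u) ω - Z t₀ ω) / ε ^ κ)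
      (𝓝[>] 0) (fun ω' : Ω' => I.restrict fun u : ℝ => T u ω') (fun _ => P) P'

/-!
All covariances are reduced to the Gaussian mixture `h(τ) = ∫_0^∞ r^(ν-1) exp (-λ² r - τ²/(4r)) dr`
with `ν = H = α - 1/2`.

The covariance of FOU is `∫ k_t k_s = Γ(α)⁻² ∫_0^∞ exp (-λ(2x+τ)) (x(x+τ))^(ν-1/2) dx` with
`τ = |t-s|`. Writing `exp (-λ y)` as a superposition of the Gaussians `exp (-y²/(4r))` in
`y = 2x + τ` (the Laplace transform of the Lévy density, `integral_levy_density`) and using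
`y² = τ² + 4x(x+τ)`, the `x`-integral becomes a gamma integral and what is left is a multiple of
`h(τ)` (`integral_exp_mul_rpow_eq_heatIntegral`). The substitution `r = |τ| eˢ / (2λ)` turns `h(τ)`
into a Bessel function (`fouCov_eq_heatIntegral`), which gives the closed form. The Lévy density
itself is the case of `K_{1/2}`, a Gaussian integral.

Near the origin, `h(0) - h(τ) = ∫ r^(ν-1) exp (-λ² r) (1 - exp (-τ²/(4r))) dr`, and `r = τ²/(4p)`
extracts the factor `|τ|^(2ν)`; the remaining integral converges by dominated convergence to
`∫ p^(-ν-1) (1 - exp (-p)) dp = Γ(1-ν)/ν` (`isLittleO_fouCov`). The constant is `A` by the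
duplication and reflection formulas. Every statement on the TFBM covariance follows, since it is
a combination of values of `fouCov`.

For the tangent process, the white noise is integrated against the spectral kernels of fractional
Brownian motion, whose Gram matrix is computed up to a positive constant by scaling alone
(`exists_isFBM`). FOU and TFBM have the same increments; the covariances of the rescaled
increments converge to those of fractional Brownian motion, and for centred Gaussian vectors this
implies convergence in distribution, by Lévy's continuity theorem
(`tendstoInDistribution_of_tendsto_covariance`).
-/

/-! ### Bessel functions and the heat-kernel integral -/

theorem integrableOn_rpow_mul_exp_neg_mul_sub_div {ν a b : ℝ} (hν : 0 < ν) (ha : 0 < a)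
    (hb : 0 ≤ b) :
    IntegrableOn (fun r : ℝ => r ^ (ν - 1) * Real.exp (-a * r - b / r)) (Set.Ioi 0) := by
  have h0 := integrableOn_rpow_mul_exp_neg_mul_rpow (p := 1) (s := ν - 1) (b := a)
    (by linarith) one_pos ha
  refine Integrable.mono' h0 (Measurable.aestronglyMeasurable (by fun_prop)) ?_
  refine ae_restrict_of_forall_mem measurableSet_Ioi fun r hr => ?_
  have hr : 0 < r := hr
  rw [Real.norm_of_nonneg (by positivity), Real.rpow_one]
  have : 0 ≤ b / r := by positivity
  gcongr
  linarith

theorem image_mul_exp_univ {ρ : ℝ} (hρ : 0 < ρ) :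
    (fun s => ρ * Real.exp s) '' Set.univ = Set.Ioi 0 := by
  ext x
  simp only [Set.image_univ, Set.mem_range, Set.mem_Ioi]
  constructor
  · rintro ⟨y, rfl⟩; positivity
  · intro hx
    exact ⟨Real.log (x / ρ), by rw [Real.exp_log (by positivity)]; field_simp⟩

theorem mul_exp_change_integrand (ν a s : ℝ) {ρ : ℝ} (hρ : 0 < ρ) :
    |ρ * Real.exp s| • ((ρ * Real.exp s) ^ (ν - 1)
        * Real.exp (-a * (ρ * Real.exp s) - a * ρ ^ 2 / (ρ * Real.exp s)))
      = ρ ^ ν * Real.exp (-(2 * a * ρ) * Real.cosh s + ν * s) := by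
  have h1 : ρ ^ ν = ρ * ρ ^ (ν - 1) := by
    rw [Real.rpow_sub_one hρ.ne']; field_simp
  have h2 : -a * (ρ * Real.exp s) - a * ρ ^ 2 / (ρ * Real.exp s)
      = -(2 * a * ρ) * Real.cosh s := by
    rw [Real.cosh_eq, Real.exp_neg]; field_simp; ring
  rw [h2, abs_of_pos (by positivity), Real.mul_rpow hρ.le (Real.exp_pos s).le, ← Real.exp_mul,
    Real.exp_add, h1, smul_eq_mul]
  have h3 : Real.exp (ν * s) = Real.exp s * Real.exp (s * (ν - 1)) := by
    rw [← Real.exp_add]; ring_nf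
  rw [h3]; ring

/-- The exponent makes the integrand decay doubly exponentially at both ends, so that every real
order `ν` is allowed. -/
theorem integrable_exp_neg_mul_cosh_add (ν : ℝ) {z : ℝ} (hz : 0 < z) :
    Integrable fun s : ℝ => Real.exp (-z * Real.cosh s + ν * s) := by
  -- Positive orders reduce to an integral on the half-line by `r = exp s`.
  have pos : ∀ μ : ℝ, 0 < μ → Integrable fun s : ℝ => Real.exp (-z * Real.cosh s + μ * s) := by
    intro μ hμ
    have h := integrableOn_rpow_mul_exp_neg_mul_sub_div (b := z / 2 * 1 ^ 2) hμ (half_pos hz)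
      (by positivity)
    rw [← image_mul_exp_univ one_pos, integrableOn_image_iff_integrableOn_abs_deriv_smul
      MeasurableSet.univ (f' := fun s => 1 * Real.exp s)
      (fun s _ => ((Real.hasDerivAt_exp s).const_mul 1).hasDerivWithinAt)
      (fun x _ y _ h => by simpa using h), integrableOn_univ] at h
    simp_rw [mul_exp_change_integrand μ (z / 2) _ one_pos] at h
    simpa [mul_div_cancel₀] using h
  have h1 := pos (|ν| + 1) (by positivity)
  refine Integrable.mono' (h1.add h1.comp_neg) (Continuous.aestronglyMeasurable (by fun_prop))
    (Eventually.of_forall fun s => ?_)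
  rw [Real.norm_of_nonneg (Real.exp_pos _).le]
  simp only [Pi.add_apply, Real.cosh_neg]
  have hs : ν * s ≤ |ν| * |s| := by rw [← abs_mul]; exact le_abs_self _
  rcases le_total 0 s with h | h
  · rw [abs_of_nonneg h] at hs
    have : Real.exp (-z * Real.cosh s + ν * s)
        ≤ Real.exp (-z * Real.cosh s + (|ν| + 1) * s) := Real.exp_le_exp.2 (by linarith)
    have := Real.exp_pos (-z * Real.cosh s + (|ν| + 1) * -s)
    linarith
  · rw [abs_of_nonpos h] at hs
    have : Real.exp (-z * Real.cosh s + ν * s)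
        ≤ Real.exp (-z * Real.cosh s + (|ν| + 1) * -s) := Real.exp_le_exp.2 (by linarith)
    have := Real.exp_pos (-z * Real.cosh s + (|ν| + 1) * s)
    linarith

theorem integral_exp_neg_mul_cosh_add (ν : ℝ) {z : ℝ} (hz : 0 < z) :
    ∫ s : ℝ, Real.exp (-z * Real.cosh s + ν * s) = 2 * besselK ν z := by
  have hi := integrable_exp_neg_mul_cosh_add ν hz
  have hi' := integrable_exp_neg_mul_cosh_add (-ν) hz
  have h1 : ∫ s in Set.Iic (0 : ℝ), Real.exp (-z * Real.cosh s + ν * s)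
      = ∫ s in Set.Ioi (0 : ℝ), Real.exp (-z * Real.cosh s + -ν * s) := by
    rw [← neg_zero, ← integral_comp_neg_Ioi]
    simp
  rw [← integral_add_compl measurableSet_Iic hi, Set.compl_Iic, h1, ← integral_add
    hi'.integrableOn hi.integrableOn, besselK, ← integral_const_mul]
  refine integral_congr_ae (Eventually.of_forall fun s => ?_)
  simp only [Real.exp_add, Real.cosh_eq (ν * s), neg_mul]
  ring

/-- The substitution `r = ρ exp s` turns the heat-kernel integral into a Bessel function. -/
theorem integral_rpow_mul_exp_eq_besselK (ν : ℝ) {a ρ : ℝ} (ha : 0 < a) (hρ : 0 < ρ) :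
    ∫ r in Set.Ioi (0 : ℝ), r ^ (ν - 1) * Real.exp (-a * r - a * ρ ^ 2 / r)
      = 2 * ρ ^ ν * besselK ν (2 * a * ρ) := by
  rw [← image_mul_exp_univ hρ, integral_image_eq_integral_abs_deriv_smul
      MeasurableSet.univ (f' := fun s => ρ * Real.exp s)
      (fun s _ => ((Real.hasDerivAt_exp s).const_mul ρ).hasDerivWithinAt)
      (fun x _ y _ h => by simpa [hρ.ne'] using h)]
  simp_rw [mul_exp_change_integrand ν a _ hρ]
  rw [setIntegral_univ, integral_const_mul, integral_exp_neg_mul_cosh_add ν (by positivity)]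
  ring

theorem besselK_neg (ν z : ℝ) : besselK (-ν) z = besselK ν z := by
  simp [besselK]

theorem image_sinh_half_Ioi : (fun s => Real.sinh (s / 2)) '' Set.Ioi 0 = Set.Ioi 0 := by
  ext x
  simp only [Set.mem_image, Set.mem_Ioi]
  constructor
  · rintro ⟨y, hy, rfl⟩; exact Real.sinh_pos_iff.2 (by linarith)
  · intro hx
    exact ⟨2 * Real.arsinh x, by have := Real.arsinh_pos_iff.2 hx; linarith,
      by rw [mul_div_cancel_left₀ _ two_ne_zero, Real.sinh_arsinh]⟩

/-- Since `cosh s = 1 + 2 sinh² (s / 2)`, order one half is a Gaussian integral in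
`sinh (s / 2)`. -/
theorem besselK_half {w : ℝ} :
    besselK (1 / 2) w = Real.exp (-w) * √(Real.pi / (2 * w)) := by
  have h := integral_gaussian_Ioi (2 * w)
  rw [← image_sinh_half_Ioi, integral_image_eq_integral_abs_deriv_smul
      (f := fun s => Real.sinh (s / 2))
      measurableSet_Ioi (f' := fun s => Real.cosh (s / 2) * (1 / 2))
      (fun s _ => (((hasDerivAt_id s).div_const 2).sinh).hasDerivWithinAt)
      (fun x _ y _ h => by simpa using h)] at h
  have e : besselK (1 / 2) w = 2 * Real.exp (-w) * ∫ s in Set.Ioi (0 : ℝ),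
      |Real.cosh (s / 2) * (1 / 2)| • Real.exp (-(2 * w) * Real.sinh (s / 2) ^ 2) := by
    rw [besselK, ← integral_const_mul]
    refine integral_congr_ae (Eventually.of_forall fun s => ?_)
    have hc : Real.cosh s = 1 + 2 * Real.sinh (s / 2) ^ 2 := by
      have h1 := Real.cosh_two_mul (s / 2)
      rw [Real.cosh_sq, mul_div_cancel₀ s two_ne_zero] at h1
      linarith
    have hp := Real.cosh_pos (s / 2)
    have he : -w * Real.cosh s = -w + -(2 * w) * Real.sinh (s / 2) ^ 2 := by rw [hc]; ring
    simp only [he, Real.exp_add, smul_eq_mul]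
    rw [abs_of_pos (by positivity), show 1 / 2 * s = s / 2 by ring]
    ring
  rw [e, h]; ring

/-- The Laplace transform of the one-sided `1/2`-stable (Lévy) density, which writes
`exp (-λ y)` as a superposition of the Gaussians `exp (-y² / (4 r))`. -/
theorem integral_levy_density {lam y : ℝ} (hlam : 0 < lam) (hy : 0 < y) :
    ∫ r in Set.Ioi (0 : ℝ), r ^ (-(1 / 2 : ℝ) - 1) * Real.exp (-lam ^ 2 * r - y ^ 2 / 4 / r)
      = 2 * √Real.pi / y * Real.exp (-lam * y) := by
  have h := integral_rpow_mul_exp_eq_besselK (-(1 / 2)) (a := lam ^ 2) (ρ := y / (2 * lam))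
    (by positivity) (by positivity)
  have e1 : lam ^ 2 * (y / (2 * lam)) ^ 2 = y ^ 2 / 4 := by field_simp; ring
  have e2 : 2 * lam ^ 2 * (y / (2 * lam)) = lam * y := by field_simp
  rw [e1, e2, besselK_neg, besselK_half, Real.rpow_neg (by positivity),
    ← Real.sqrt_eq_rpow] at h
  rw [h, Real.sqrt_div' _ (by positivity), Real.sqrt_div' _ (by positivity)]
  have e3 : √(2 * (lam * y)) = √(2 * lam) * √y := by
    rw [← mul_assoc, Real.sqrt_mul (by positivity)]
  rw [e3, neg_mul]
  have hs := Real.mul_self_sqrt hy.le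
  have h1 : 0 < √y := by positivity
  have h2 : 0 < √(2 * lam) := by positivity
  field_simp
  rw [sq, hs]

/-! ### The covariance integral as a mixture of Gaussians -/

/-- The mixture `∫_0^∞ r^(ν-1) exp (-λ² r - τ² / (4 r)) dr` of Gaussians in `τ`. -/
noncomputable def heatIntegral (ν lam τ : ℝ) : ℝ :=
  ∫ r in Set.Ioi (0 : ℝ), r ^ (ν - 1) * Real.exp (-lam ^ 2 * r - τ ^ 2 / 4 / r)

theorem integrableOn_heatIntegral {ν lam : ℝ} (τ : ℝ) (hν : 0 < ν) (hlam : 0 < lam) :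
    IntegrableOn (fun r : ℝ => r ^ (ν - 1) * Real.exp (-lam ^ 2 * r - τ ^ 2 / 4 / r))
      (Set.Ioi 0) :=
  integrableOn_rpow_mul_exp_neg_mul_sub_div hν (by positivity) (by positivity)

theorem image_mul_self_add_Ioi {τ : ℝ} (hτ : 0 ≤ τ) :
    (fun x => x * (x + τ)) '' Set.Ioi 0 = Set.Ioi 0 := by
  ext q
  simp only [Set.mem_image, Set.mem_Ioi]
  constructor
  · rintro ⟨y, hy, rfl⟩; positivity
  · intro hq
    -- the positive root of `x² + τ x = q`
    have hs : τ < √(τ ^ 2 + 4 * q) := Real.lt_sqrt_of_sq_lt (by linarith)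
    refine ⟨(√(τ ^ 2 + 4 * q) - τ) / 2, by linarith, ?_⟩
    have := Real.sq_sqrt (show 0 ≤ τ ^ 2 + 4 * q by positivity)
    linear_combination this / 4

theorem injOn_mul_self_add_Ioi {τ : ℝ} (hτ : 0 ≤ τ) :
    Set.InjOn (fun x => x * (x + τ)) (Set.Ioi 0) := by
  intro x hx y hy h
  have hx : 0 < x := hx
  have hy : 0 < y := hy
  have h : (x - y) * (x + y + τ) = 0 := by
    have : x * (x + τ) = y * (y + τ) := h
    linear_combination this
  rcases mul_eq_zero.1 h with h | h <;> linarith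

theorem hasDerivWithinAt_mul_self_add (τ x : ℝ) (s : Set ℝ) :
    HasDerivWithinAt (fun x => x * (x + τ)) (2 * x + τ) s x := by
  have := ((hasDerivAt_id x).mul ((hasDerivAt_id x).add_const τ)).hasDerivWithinAt (s := s)
  convert! this using 1
  simp; ring

theorem integrableOn_mul_self_add_gamma {μ τ r : ℝ} (hμ : 0 < μ) (hτ : 0 ≤ τ) (hr : 0 < r) :
    IntegrableOn (fun x => (2 * x + τ) * ((x * (x + τ)) ^ (μ - 1)
      * Real.exp (-(1 / r * (x * (x + τ)))))) (Set.Ioi 0) := by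
  have h : IntegrableOn (fun q : ℝ => q ^ (μ - 1) * Real.exp (-(1 / r * q))) (Set.Ioi 0) := by
    have h0 := integrableOn_rpow_mul_exp_neg_mul_rpow (p := 1) (s := μ - 1) (b := 1 / r)
      (by linarith) one_pos (by positivity)
    simpa using h0
  rw [← image_mul_self_add_Ioi hτ, integrableOn_image_iff_integrableOn_abs_deriv_smul
    measurableSet_Ioi (fun x _ => hasDerivWithinAt_mul_self_add τ x _)
    (injOn_mul_self_add_Ioi hτ)] at h
  refine h.congr_fun (fun x hx => ?_) measurableSet_Ioi
  have hx : 0 < x := hx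
  simp only [smul_eq_mul]
  rw [abs_of_pos (by positivity)]

theorem integral_mul_self_add_gamma {μ τ r : ℝ} (hμ : 0 < μ) (hτ : 0 ≤ τ) (hr : 0 < r) :
    ∫ x in Set.Ioi (0 : ℝ), (2 * x + τ) * ((x * (x + τ)) ^ (μ - 1)
      * Real.exp (-(1 / r * (x * (x + τ))))) = r ^ μ * Real.Gamma μ := by
  have h := Real.integral_rpow_mul_exp_neg_mul_Ioi hμ (one_div_pos.2 hr)
  rw [← image_mul_self_add_Ioi hτ, integral_image_eq_integral_abs_deriv_smul
    measurableSet_Ioi (fun x _ => hasDerivWithinAt_mul_self_add τ x _)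
    (injOn_mul_self_add_Ioi hτ), one_div_one_div] at h
  rw [← h]
  refine setIntegral_congr_fun measurableSet_Ioi (fun x hx => ?_)
  have hx : 0 < x := hx
  simp only [smul_eq_mul]
  rw [abs_of_pos (by positivity)]

/-- Expanding `exp (-λ (2 x + τ))` into Gaussians in `2 x + τ` and exchanging the two integrals
leaves, for each Gaussian, a gamma integral in `x (x + τ) = ((2 x + τ)² - τ²) / 4`. -/
theorem integral_exp_mul_rpow_eq_heatIntegral {ν lam τ : ℝ} (hν : 0 < ν) (hlam : 0 < lam)
    (hτ : 0 ≤ τ) :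
    ∫ x in Set.Ioi (0 : ℝ), Real.exp (-lam * (2 * x + τ)) * (x * (x + τ)) ^ (ν - 1 / 2)
      = Real.Gamma (ν + 1 / 2) / (2 * √Real.pi) * heatIntegral ν lam τ := by
  set F : ℝ → ℝ → ℝ := fun x r => (2 * x + τ) / (2 * √Real.pi) * (x * (x + τ)) ^ (ν - 1 / 2) *
    (r ^ (-(1 / 2 : ℝ) - 1) * Real.exp (-lam ^ 2 * r - (2 * x + τ) ^ 2 / 4 / r)) with hF
  have hpi : 0 < √Real.pi := Real.sqrt_pos.2 Real.pi_pos
  have hμ : 0 < ν + 1 / 2 := by linarith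
  have eF : ∀ x r : ℝ, 0 < r → F x r
      = (1 / (2 * √Real.pi) * r ^ (-(1 / 2 : ℝ) - 1) * Real.exp (-lam ^ 2 * r - τ ^ 2 / 4 / r))
        * ((2 * x + τ) * ((x * (x + τ)) ^ (ν + 1 / 2 - 1)
          * Real.exp (-(1 / r * (x * (x + τ)))))) := by
    intro x r hr
    have e1 : -lam ^ 2 * r - (2 * x + τ) ^ 2 / 4 / r
        = (-lam ^ 2 * r - τ ^ 2 / 4 / r) + -(1 / r * (x * (x + τ))) := by
      field_simp; ring
    simp only [hF]
    rw [e1, Real.exp_add, show ν + 1 / 2 - 1 = ν - 1 / 2 by ring]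
    ring
  -- The integral over `x`, a gamma integral.
  have hin : ∀ r : ℝ, 0 < r → ∫ x in Set.Ioi (0 : ℝ), F x r
      = Real.Gamma (ν + 1 / 2) / (2 * √Real.pi)
        * (r ^ (ν - 1) * Real.exp (-lam ^ 2 * r - τ ^ 2 / 4 / r)) := by
    intro r hr
    simp_rw [fun x => eF x r hr]
    rw [integral_const_mul, integral_mul_self_add_gamma hμ hτ hr]
    have : r ^ (ν - 1) = r ^ (-(1 / 2 : ℝ) - 1) * r ^ (ν + 1 / 2) := by
      rw [← Real.rpow_add hr]; ring_nf
    rw [this]; ring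
  have hnn : ∀ x r : ℝ, 0 < x → 0 < r → 0 ≤ F x r := by
    intro x r hx hr
    simp only [hF]
    positivity
  have hint : Integrable (Function.uncurry F)
      ((volume.restrict (Set.Ioi (0 : ℝ))).prod (volume.restrict (Set.Ioi (0 : ℝ)))) := by
    have hm : Measurable (Function.uncurry F) := by
      simp only [hF, Function.uncurry_def]
      fun_prop
    rw [integrable_prod_iff' hm.aestronglyMeasurable]
    constructor
    · refine ae_restrict_of_forall_mem measurableSet_Ioi fun r hr => ?_
      simp only [Function.uncurry_apply_pair]
      simp_rw [fun x => eF x r hr]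
      exact (integrableOn_mul_self_add_gamma hμ hτ hr).const_mul _
    · refine ((integrableOn_heatIntegral τ hν hlam).const_mul
        (Real.Gamma (ν + 1 / 2) / (2 * √Real.pi))).congr ?_
      refine ae_restrict_of_forall_mem measurableSet_Ioi fun r hr => ?_
      simp only [Function.uncurry_apply_pair]
      rw [← hin r hr]
      refine setIntegral_congr_fun measurableSet_Ioi (fun x hx => ?_)
      exact (Real.norm_of_nonneg (hnn x r hx hr)).symm
  -- The integral over `r`, the Laplace transform of the Lévy density.
  have hout : ∀ x : ℝ, 0 < x → ∫ r in Set.Ioi (0 : ℝ), F x r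
      = Real.exp (-lam * (2 * x + τ)) * (x * (x + τ)) ^ (ν - 1 / 2) := by
    intro x hx
    have hy : 0 < 2 * x + τ := by positivity
    simp only [hF]
    rw [integral_const_mul, integral_levy_density hlam hy]
    field_simp
  calc _ = ∫ x in Set.Ioi (0 : ℝ), ∫ r in Set.Ioi (0 : ℝ), F x r :=
        setIntegral_congr_fun measurableSet_Ioi fun x hx => (hout x hx).symm
    _ = ∫ r in Set.Ioi (0 : ℝ), ∫ x in Set.Ioi (0 : ℝ), F x r := integral_integral_swap hint
    _ = _ := by
      rw [setIntegral_congr_fun measurableSet_Ioi fun r hr => hin r hr, integral_const_mul,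
        heatIntegral]

theorem heatIntegral_zero {ν lam : ℝ} (hν : 0 < ν) (hlam : 0 < lam) :
    heatIntegral ν lam 0 = Real.Gamma ν / lam ^ (2 * ν) := by
  have h := Real.integral_rpow_mul_exp_neg_mul_Ioi hν (show 0 < lam ^ 2 by positivity)
  simp only [heatIntegral]
  rw [one_div, Real.inv_rpow (by positivity), ← Real.rpow_natCast, ← Real.rpow_mul hlam.le] at h
  rw [div_eq_inv_mul (Real.Gamma ν)]
  simpa using h

/-- The closed form of the covariance is the Gaussian mixture; at `τ = 0` this is Legendre's
duplication formula. -/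
theorem fouCov_eq_heatIntegral {α lam : ℝ} (hα : 1 / 2 < α) (hlam : 0 < lam) (τ : ℝ) :
    fouCov α lam τ
      = 1 / (2 * √Real.pi * Real.Gamma α) * heatIntegral (α - 1 / 2) lam τ := by
  have hν : 0 < α - 1 / 2 := by linarith
  have hpi : 0 < √Real.pi := Real.sqrt_pos.2 Real.pi_pos
  have hG : 0 < Real.Gamma α := Real.Gamma_pos_of_pos (by linarith)
  unfold fouCov
  split_ifs with h0
  · rw [h0, heatIntegral_zero hν hlam]
    have hd := Real.Gamma_mul_Gamma_add_half (α - 1 / 2)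
    rw [sub_add_cancel, show 2 * (α - 1 / 2) = 2 * α - 1 by ring,
      Real.rpow_sub two_pos, Real.rpow_one] at hd
    rw [Real.mul_rpow two_pos.le hlam.le, show 2 * (α - 1 / 2) = 2 * α - 1 by ring]
    have h2 : (0 : ℝ) < 2 ^ (2 * α - 1) := by positivity
    have hl : (0 : ℝ) < lam ^ (2 * α - 1) := by positivity
    field_simp at hd ⊢
    linarith
  · have hτ : 0 < |τ| := abs_pos.2 h0
    have h := integral_rpow_mul_exp_eq_besselK (α - 1 / 2) (a := lam ^ 2) (ρ := |τ| / (2 * lam))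
      (by positivity) (by positivity)
    have e1 : lam ^ 2 * (|τ| / (2 * lam)) ^ 2 = τ ^ 2 / 4 := by
      rw [← sq_abs τ]; field_simp; ring
    have e2 : 2 * lam ^ 2 * (|τ| / (2 * lam)) = lam * |τ| := by field_simp
    rw [e1, e2] at h
    rw [heatIntegral, h]
    field_simp

/-! ### Covariances of the two processes -/

theorem integral_wienerIntegral_mul {Ω : Type*} [MeasurableSpace Ω] {P : Measure Ω}
    {W : Lp ℝ 2 (volume : Measure ℝ) → Ω → ℝ} (hW : IsWhiteNoise W P) {f g : ℝ → ℝ}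
    (hf : MemLp f 2 volume) (hg : MemLp g 2 volume) :
    ∫ ω, wienerIntegral W f ω * wienerIntegral W g ω ∂P = ∫ u, f u * g u := by
  simp only [wienerIntegral, hf, hg, dif_pos]
  rw [hW.covariance, L2.inner_def]
  refine integral_congr_ae ?_
  filter_upwards [hf.coeFn_toLp, hg.coeFn_toLp] with u h1 h2
  rw [h1, h2]
  simp [mul_comm]

theorem integral_fouKernel_mul_of_le {α lam : ℝ} (hα : 1 / 2 < α) (hlam : 0 < lam) {t s : ℝ}
    (hst : s ≤ t) :
    ∫ u, fouKernel α lam t u * fouKernel α lam s u = fouCov α lam (t - s) := by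
  have hG : 0 < Real.Gamma α := Real.Gamma_pos_of_pos (by linarith)
  have hpi : 0 < √Real.pi := Real.sqrt_pos.2 Real.pi_pos
  have h := integral_exp_mul_rpow_eq_heatIntegral (ν := α - 1 / 2) (lam := lam) (τ := t - s)
    (by linarith) hlam (by linarith)
  rw [fouCov_eq_heatIntegral hα hlam]
  have e : ∫ u, fouKernel α lam t u * fouKernel α lam s u
      = (Real.Gamma α ^ 2)⁻¹ * ∫ x in Set.Ioi (0 : ℝ), Real.exp (-lam * (2 * x + (t - s)))
        * (x * (x + (t - s))) ^ (α - 1 / 2 - 1 / 2) := by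
    -- `u = s - x` moves the common support `u < s` to the half-line.
    rw [← integral_sub_left_eq_self _ volume s, ← integral_const_mul,
      ← integral_indicator measurableSet_Ioi]
    refine integral_congr_ae (Eventually.of_forall fun x => ?_)
    by_cases hx : 0 < x
    · have h1 : s - x < t := by linarith
      have h2 : s - x < s := by linarith
      have e1 : Real.exp (-lam * (2 * x + (t - s)))
          = Real.exp (-lam * (t - (s - x))) * Real.exp (-lam * (s - (s - x))) := by
        rw [← Real.exp_add]; ring_nf
      have e2 : (x * (x + (t - s))) ^ (α - 1 / 2 - 1 / 2)
          = (t - (s - x)) ^ (α - 1) * (s - (s - x)) ^ (α - 1) := by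
        rw [← Real.mul_rpow (by linarith) (by linarith)]
        ring_nf
      simp only [fouKernel, h1, h2, if_true, Set.indicator, Set.mem_Ioi, hx, e1, e2]
      field_simp
    · simp [fouKernel, hx, Set.indicator]
  rw [e, h, sub_add_cancel]
  field_simp

theorem fouCov_neg (α lam τ : ℝ) : fouCov α lam (-τ) = fouCov α lam τ := by
  simp [fouCov]

theorem integral_fou_mul {Ω : Type*} [MeasurableSpace Ω] {P : Measure Ω}
    {W : Lp ℝ 2 (volume : Measure ℝ) → Ω → ℝ} (hW : IsWhiteNoise W P) {α lam : ℝ}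
    (hα : 1 / 2 < α) (hlam : 0 < lam) (t s : ℝ) :
    ∫ ω, fou W α lam t ω * fou W α lam s ω ∂P = fouCov α lam (t - s) := by
  unfold fou
  rw [integral_wienerIntegral_mul hW (memLp_fouKernel hα hlam t) (memLp_fouKernel hα hlam s)]
  rcases le_total s t with h | h
  · exact integral_fouKernel_mul_of_le hα hlam h
  · rw [← neg_sub, fouCov_neg, ← integral_fouKernel_mul_of_le hα hlam h]
    simp_rw [mul_comm]

theorem isGaussianProcess_fou {Ω : Type*} [MeasurableSpace Ω] {P : Measure Ω}
    {W : Lp ℝ 2 (volume : Measure ℝ) → Ω → ℝ} (hW : IsWhiteNoise W P) {α lam : ℝ}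
    (hα : 1 / 2 < α) (hlam : 0 < lam) : IsGaussianProcess (fou W α lam) P := by
  have : fou W α lam = W ∘ fun t => (memLp_fouKernel hα hlam t).toLp (fouKernel α lam t) := by
    ext t ω
    simp [fou, wienerIntegral, memLp_fouKernel hα hlam t]
  rw [this]
  exact hW.gaussian.comp_right _

theorem integral_fou {Ω : Type*} [MeasurableSpace Ω] {P : Measure Ω}
    {W : Lp ℝ 2 (volume : Measure ℝ) → Ω → ℝ} (hW : IsWhiteNoise W P) {α lam : ℝ}
    (hα : 1 / 2 < α) (hlam : 0 < lam) (t : ℝ) : ∫ ω, fou W α lam t ω ∂P = 0 := by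
  simp only [fou, wienerIntegral, memLp_fouKernel hα hlam t, dif_pos]
  exact hW.centred _

theorem integral_fou_sub_mul_sub {Ω : Type*} [MeasurableSpace Ω] {P : Measure Ω}
    {W : Lp ℝ 2 (volume : Measure ℝ) → Ω → ℝ} (hW : IsWhiteNoise W P) {α lam : ℝ}
    (hα : 1 / 2 < α) (hlam : 0 < lam) (t s r : ℝ) :
    ∫ ω, (fou W α lam t ω - fou W α lam r ω) * (fou W α lam s ω - fou W α lam r ω) ∂P
      = tfbmCov α lam (t - r) (s - r) := by
  have hX : ∀ t, MemLp (fou W α lam t) 2 P := fun t =>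
    ((isGaussianProcess_fou hW hα hlam).hasGaussianLaw_eval t).memLp_two
  have hi : ∀ t s, Integrable (fun ω => fou W α lam t ω * fou W α lam s ω) P :=
    fun t s => (hX t).integrable_mul (hX s)
  have e : ∀ ω, (fou W α lam t ω - fou W α lam r ω) * (fou W α lam s ω - fou W α lam r ω)
      = fou W α lam t ω * fou W α lam s ω - fou W α lam t ω * fou W α lam r ω
        - fou W α lam r ω * fou W α lam s ω + fou W α lam r ω * fou W α lam r ω :=
    fun ω => by ring
  have h1 : Integrable (fun ω => fou W α lam t ω * fou W α lam s ω
      - fou W α lam t ω * fou W α lam r ω) P := (hi t s).sub (hi t r)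
  have h2 : Integrable (fun ω => fou W α lam t ω * fou W α lam s ω
      - fou W α lam t ω * fou W α lam r ω - fou W α lam r ω * fou W α lam s ω) P :=
    h1.sub (hi r s)
  simp_rw [e]
  rw [integral_add h2 (hi r r), integral_sub h1 (hi r s), integral_sub (hi t s) (hi t r)]
  simp only [integral_fou_mul hW hα hlam, tfbmCov]
  rw [← neg_sub s r, fouCov_neg, sub_self, sub_sub_sub_cancel_right]

/-! ### The covariance near the origin -/

/-- Integrability on the half-line from power bounds at `0` and at `∞`. -/
theorem integrableOn_Ioi_of_le_rpow {f : ℝ → ℝ} {a b C : ℝ} (ha : -1 < a) (hb : b < -1)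
    (hf : Measurable f) (h0 : ∀ x, 0 < x → x ≤ 1 → |f x| ≤ C * x ^ a)
    (h1 : ∀ x, 1 < x → |f x| ≤ C * x ^ b) : IntegrableOn f (Set.Ioi 0) := by
  rw [← Set.Ioc_union_Ioi_eq_Ioi zero_le_one, integrableOn_union]
  constructor
  · have hi := (intervalIntegral.intervalIntegrable_rpow' (a := 0) (b := 1) ha).1
    refine Integrable.mono' (hi.const_mul C) hf.aestronglyMeasurable ?_
    exact ae_restrict_of_forall_mem measurableSet_Ioc fun x hx => h0 x hx.1 hx.2
  · have hi := integrableOn_Ioi_rpow_of_lt hb zero_lt_one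
    refine Integrable.mono' (hi.const_mul C) hf.aestronglyMeasurable ?_
    exact ae_restrict_of_forall_mem measurableSet_Ioi fun x hx => h1 x hx

theorem one_sub_exp_neg_nonneg {p : ℝ} (hp : 0 < p) : 0 ≤ 1 - Real.exp (-p) := by
  have : Real.exp (-p) ≤ 1 := Real.exp_le_one_iff.2 (by linarith)
  linarith

theorem one_sub_exp_neg_le (p : ℝ) : 1 - Real.exp (-p) ≤ p := by
  have := Real.add_one_le_exp (-p)
  linarith

theorem one_sub_exp_neg_le_one (p : ℝ) : 1 - Real.exp (-p) ≤ 1 := by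
  have := Real.exp_pos (-p)
  linarith

theorem integrableOn_rpow_mul_one_sub_exp {ν : ℝ} (hν : 0 < ν) (hν' : ν < 1) :
    IntegrableOn (fun p : ℝ => p ^ (-ν - 1) * (1 - Real.exp (-p))) (Set.Ioi 0) := by
  refine integrableOn_Ioi_of_le_rpow (a := -ν) (b := -ν - 1) (C := 1) (by linarith)
    (by linarith) (by fun_prop) (fun x hx _ => ?_) (fun x hx => ?_)
  · rw [abs_of_nonneg (mul_nonneg (by positivity) (one_sub_exp_neg_nonneg hx)), one_mul]
    calc x ^ (-ν - 1) * (1 - Real.exp (-x)) ≤ x ^ (-ν - 1) * x := by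
          gcongr; exact one_sub_exp_neg_le x
      _ = x ^ (-ν) := by rw [Real.rpow_sub_one hx.ne']; field_simp
  · have hx0 : 0 < x := by linarith
    rw [abs_of_nonneg (mul_nonneg (by positivity) (one_sub_exp_neg_nonneg hx0)), one_mul]
    exact mul_le_of_le_one_right (by positivity) (one_sub_exp_neg_le_one x)

/-- Integration by parts, lowering the order of the singularity at `0`. -/
theorem integral_rpow_mul_one_sub_exp {ν : ℝ} (hν : 0 < ν) (hν' : ν < 1) :
    ∫ p in Set.Ioi (0 : ℝ), p ^ (-ν - 1) * (1 - Real.exp (-p)) = Real.Gamma (1 - ν) / ν := by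
  have hG : IntegrableOn (fun p : ℝ => Real.exp (-p) * p ^ (-ν)) (Set.Ioi 0) := by
    have := Real.GammaIntegral_convergent (s := 1 - ν) (by linarith)
    simpa [show 1 - ν - 1 = -ν by ring] using this
  have hv : ∀ x ∈ Set.Ioi (0 : ℝ), HasDerivAt (fun p : ℝ => -(p ^ (-ν)) / ν) (x ^ (-ν - 1)) x := by
    intro x hx
    have hx : 0 < x := hx
    have := ((Real.hasDerivAt_rpow_const (p := -ν) (Or.inl hx.ne')).neg).div_const ν
    convert! this using 1
    field_simp
  have hu : ∀ x ∈ Set.Ioi (0 : ℝ), HasDerivAt (fun p : ℝ => 1 - Real.exp (-p))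
      (Real.exp (-x)) x := by
    intro x _
    have := ((hasDerivAt_neg x).exp).const_sub 1
    simpa using this
  have l0 : Tendsto ((fun p : ℝ => 1 - Real.exp (-p)) * fun p : ℝ => -(p ^ (-ν)) / ν) (𝓝[>] 0)
      (𝓝 0) := by
    have hz : Tendsto (fun p : ℝ => p ^ (1 - ν) / ν) (𝓝[>] 0) (𝓝 0) := by
      have : ContinuousAt (fun p : ℝ => p ^ (1 - ν) / ν) 0 :=
        (Real.continuousAt_rpow_const _ _ (Or.inr (by linarith))).div_const ν
      have h := this.tendsto.mono_left (nhdsWithin_le_nhds (s := Set.Ioi 0))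
      rwa [Real.zero_rpow (by linarith), zero_div] at h
    refine squeeze_zero_norm' ?_ hz
    filter_upwards [self_mem_nhdsWithin] with p hp
    have hp : 0 < p := hp
    have e : p ^ (1 - ν) = p * p ^ (-ν) := by
      rw [sub_eq_add_neg, Real.rpow_add hp, Real.rpow_one]
    have e2 : ‖((fun p : ℝ => 1 - Real.exp (-p)) * fun p : ℝ => -(p ^ (-ν)) / ν) p‖
        = (1 - Real.exp (-p)) * p ^ (-ν) / ν := by
      simp only [Pi.mul_apply, norm_mul, norm_div, norm_neg, Real.norm_eq_abs]
      rw [abs_of_nonneg (one_sub_exp_neg_nonneg hp), abs_of_pos hν, abs_of_pos (by positivity)]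
      ring
    rw [e2, e]
    gcongr
    exact one_sub_exp_neg_le p
  have l1 : Tendsto ((fun p : ℝ => 1 - Real.exp (-p)) * fun p : ℝ => -(p ^ (-ν)) / ν) atTop
      (𝓝 0) := by
    have hz : Tendsto (fun p : ℝ => -(p ^ (-ν)) / ν) atTop (𝓝 0) := by
      simpa using ((tendsto_rpow_neg_atTop hν).neg).div_const ν
    have ho : Tendsto (fun p : ℝ => 1 - Real.exp (-p)) atTop (𝓝 1) := by
      simpa using (Real.tendsto_exp_neg_atTop_nhds_zero).const_sub 1
    have := ho.mul hz
    rw [mul_zero] at this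
    exact this
  have h := integral_Ioi_mul_deriv_eq_deriv_mul hu hv
    ((integrableOn_rpow_mul_one_sub_exp hν hν').congr_fun
      (fun p _ => by simp [mul_comm]) measurableSet_Ioi)
    (IntegrableOn.congr_fun (hG.const_mul (-1 / ν))
      (fun p _ => by simp; ring) measurableSet_Ioi) l0 l1
  have e : ∫ p in Set.Ioi (0 : ℝ), Real.exp (-p) * (-(p ^ (-ν)) / ν)
      = -(Real.Gamma (1 - ν) / ν) := by
    rw [Real.Gamma_eq_integral (by linarith), div_eq_inv_mul, ← integral_const_mul,
      ← integral_neg]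
    refine integral_congr_ae (Eventually.of_forall fun p => ?_)
    simp only [show 1 - ν - 1 = -ν by ring]
    ring
  rw [e] at h
  simp_rw [mul_comm (_ ^ (-ν - 1) : ℝ)]
  linarith

/-- The normalised increment `(h(0) - h(τ)) / (τ² / 4)^ν` of the Gaussian mixture `h`. -/
noncomputable def heatIncrement (ν lam τ : ℝ) : ℝ :=
  ∫ p in Set.Ioi (0 : ℝ), p ^ (-ν - 1) * (1 - Real.exp (-p)) * Real.exp (-lam ^ 2 * τ ^ 2 / 4 / p)

theorem integral_Ioi_eq_integral_inv (g : ℝ → ℝ) {b : ℝ} (hb : 0 < b) :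
    ∫ r in Set.Ioi (0 : ℝ), g r = ∫ p in Set.Ioi (0 : ℝ), b * p ^ (-2 : ℝ) * g (b / p) := by
  have h1 := integral_comp_mul_left_Ioi g 0 hb
  have h2 := integral_comp_rpow_Ioi (fun r => g (b * r)) (p := -1) (by norm_num)
  rw [mul_zero, ← h2, smul_eq_mul, eq_inv_mul_iff_mul_eq₀ hb.ne', ← integral_const_mul] at h1
  rw [← h1]
  refine setIntegral_congr_fun measurableSet_Ioi fun p hp => ?_
  have hp : 0 < p := hp
  simp only [smul_eq_mul, abs_neg, abs_one, one_mul, Real.rpow_neg_one]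
  rw [show (-1 - 1 : ℝ) = -2 by norm_num, div_eq_mul_inv]
  ring

theorem heatIntegral_zero_sub {ν lam : ℝ} (τ : ℝ) (hν : 0 < ν) (hlam : 0 < lam) :
    heatIntegral ν lam 0 - heatIntegral ν lam τ = (τ ^ 2 / 4) ^ ν * heatIncrement ν lam τ := by
  rcases eq_or_ne τ 0 with rfl | hτ
  · simp [Real.zero_rpow hν.ne']
  have hb : 0 < τ ^ 2 / 4 := by positivity
  unfold heatIntegral
  rw [← integral_sub (integrableOn_heatIntegral 0 hν hlam) (integrableOn_heatIntegral τ hν hlam),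
    integral_Ioi_eq_integral_inv _ hb, heatIncrement, ← integral_const_mul]
  refine setIntegral_congr_fun measurableSet_Ioi fun p hp => ?_
  have hp : 0 < p := hp
  have e1 : -lam ^ 2 * (τ ^ 2 / 4 / p) - 0 ^ 2 / 4 / (τ ^ 2 / 4 / p)
      = -lam ^ 2 * τ ^ 2 / 4 / p := by simp; ring
  have e2 : -lam ^ 2 * (τ ^ 2 / 4 / p) - τ ^ 2 / 4 / (τ ^ 2 / 4 / p)
      = -lam ^ 2 * τ ^ 2 / 4 / p + -p := by field_simp; ring
  have e3 : (τ ^ 2 / 4) ^ ν = τ ^ 2 / 4 * (τ ^ 2 / 4) ^ (ν - 1) := by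
    rw [Real.rpow_sub_one hb.ne']; field_simp
  have e4 : p ^ (-2 : ℝ) = p ^ (-ν - 1) * p ^ (ν - 1) := by
    rw [← Real.rpow_add hp]; ring_nf
  simp only [e1, e2, e3, e4, Real.exp_add, Real.div_rpow hb.le hp.le]
  field_simp

theorem tendsto_heatIncrement {ν : ℝ} (lam : ℝ) (hν : 0 < ν) (hν' : ν < 1) :
    Tendsto (heatIncrement ν lam) (𝓝 0) (𝓝 (Real.Gamma (1 - ν) / ν)) := by
  rw [← integral_rpow_mul_one_sub_exp hν hν']
  refine tendsto_integral_filter_of_dominated_convergence _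
    (Eventually.of_forall fun τ => Measurable.aestronglyMeasurable (by fun_prop))
    (Eventually.of_forall fun τ => ?_) (integrableOn_rpow_mul_one_sub_exp hν hν')
    (ae_restrict_of_forall_mem measurableSet_Ioi fun p hp => ?_)
  · refine ae_restrict_of_forall_mem measurableSet_Ioi fun p hp => ?_
    have hp : 0 < p := hp
    have h1 := one_sub_exp_neg_nonneg hp
    rw [Real.norm_of_nonneg (by positivity)]
    refine mul_le_of_le_one_right (by positivity) (Real.exp_le_one_iff.2 ?_)
    rw [neg_mul, neg_div, neg_div, neg_nonpos]
    positivity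
  · have hc : Continuous fun τ : ℝ =>
        p ^ (-ν - 1) * (1 - Real.exp (-p)) * Real.exp (-lam ^ 2 * τ ^ 2 / 4 / p) := by fun_prop
    simpa using hc.tendsto 0

/-- The variance constant, as it comes out of the Gaussian mixture; the duplication and
reflection formulas for `Γ` give the closed form. -/
theorem neg_one_div_gamma_mul_cos {α : ℝ} (hα : 1 / 2 < α) (hα' : α < 3 / 2) :
    -1 / (2 * Real.Gamma (2 * α) * Real.cos (α * Real.pi))
      = 1 / (2 * √Real.pi * Real.Gamma α) * (4 ^ (α - 1 / 2))⁻¹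
        * (Real.Gamma (1 - (α - 1 / 2)) / (α - 1 / 2)) := by
  set ν := α - 1 / 2 with hνd
  have hν : 0 < ν := by linarith
  have hν' : ν < 1 := by linarith
  have eα : α = ν + 1 / 2 := by rw [hνd]; ring
  have hsin : 0 < Real.sin (Real.pi * ν) :=
    Real.sin_pos_of_pos_of_lt_pi (by positivity) (by nlinarith [Real.pi_pos])
  have ecos : Real.cos (α * Real.pi) = -Real.sin (Real.pi * ν) := by
    rw [← Real.cos_add_pi_div_two, eα]; ring_nf
  have hd := Real.Gamma_mul_Gamma_add_half ν
  have hr := Real.Gamma_mul_Gamma_one_sub ν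
  have eG : Real.Gamma (2 * α) = 2 * ν * Real.Gamma (2 * ν) := by
    rw [← Real.Gamma_add_one (by positivity), eα]; ring_nf
  have hpi : 0 < √Real.pi := Real.sqrt_pos.2 Real.pi_pos
  have hpi2 := Real.mul_self_sqrt Real.pi_pos.le
  have e4 : (4 : ℝ) ^ ν = 2 ^ (2 * ν) := by
    rw [Real.rpow_mul two_pos.le]; norm_num
  rw [Real.rpow_sub two_pos, Real.rpow_one] at hd
  rw [ecos, eG, e4, eα]
  have g1 : 0 < Real.Gamma ν := Real.Gamma_pos_of_pos hν
  have g2 : 0 < Real.Gamma (ν + 1 / 2) := Real.Gamma_pos_of_pos (by linarith)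
  have g3 : 0 < Real.Gamma (2 * ν) := Real.Gamma_pos_of_pos (by linarith)
  have g4 : 0 < Real.Gamma (1 - ν) := Real.Gamma_pos_of_pos (by linarith)
  have g5 : (0 : ℝ) < 2 ^ (2 * ν) := by positivity
  have h1 : Real.Gamma (1 - ν) = Real.pi / Real.sin (Real.pi * ν) / Real.Gamma ν := by
    rw [← hr]; field_simp
  have h2 : Real.Gamma (ν + 1 / 2)
      = Real.Gamma (2 * ν) * (2 / 2 ^ (2 * ν)) * √Real.pi / Real.Gamma ν := by
    rw [← hd]; field_simp
  rw [h1, h2]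
  field_simp
  rw [sq, hpi2]

theorem neg_one_div_gamma_mul_cos_pos {α : ℝ} (hα : 1 / 2 < α) (hα' : α < 3 / 2) :
    0 < -1 / (2 * Real.Gamma (2 * α) * Real.cos (α * Real.pi)) := by
  have g1 : 0 < Real.Gamma (2 * α) := Real.Gamma_pos_of_pos (by linarith)
  have hc : Real.cos (α * Real.pi) < 0 :=
    Real.cos_neg_of_pi_div_two_lt_of_lt (by nlinarith [Real.pi_pos]) (by nlinarith [Real.pi_pos])
  exact div_pos_of_neg_of_neg (by norm_num) (mul_neg_of_pos_of_neg (by positivity) hc)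

theorem neg_one_div_gamma_mul_cos_eq_of_ne_half {α H : ℝ} (hα : 1 / 2 < α) (hα' : α < 3 / 2)
    (hH : H = α - 1 / 2) (hne : H ≠ 1 / 2) :
    -1 / (2 * Real.Gamma (2 * α) * Real.cos (α * Real.pi))
      = Real.Gamma (1 - 2 * H) * Real.cos (H * Real.pi) / (2 * H * Real.pi) := by
  have eα : α = H + 1 / 2 := by linarith
  have hH0 : 0 < H := by linarith
  have hpi := Real.pi_pos
  have hsin : 0 < Real.sin (H * Real.pi) :=
    Real.sin_pos_of_pos_of_lt_pi (by positivity) (by nlinarith)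
  have hcos : Real.cos (H * Real.pi) ≠ 0 := by
    rcases lt_or_gt_of_ne hne with h | h
    · exact (Real.cos_pos_of_mem_Ioo ⟨by nlinarith, by nlinarith⟩).ne'
    · exact (Real.cos_neg_of_pi_div_two_lt_of_lt (by nlinarith) (by nlinarith)).ne
  have ecos : Real.cos (α * Real.pi) = -Real.sin (H * Real.pi) := by
    rw [← Real.cos_add_pi_div_two, eα]; ring_nf
  have eG : Real.Gamma (2 * α) = 2 * H * Real.Gamma (2 * H) := by
    rw [← Real.Gamma_add_one (by positivity), eα]; ring_nf
  have hr := Real.Gamma_mul_Gamma_one_sub (2 * H)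
  rw [show Real.pi * (2 * H) = 2 * (H * Real.pi) by ring, Real.sin_two_mul] at hr
  have g : 0 < Real.Gamma (2 * H) := Real.Gamma_pos_of_pos (by linarith)
  have h1 : Real.Gamma (1 - 2 * H)
      = Real.pi / (2 * Real.sin (H * Real.pi) * Real.cos (H * Real.pi)) / Real.Gamma (2 * H) := by
    rw [← hr]; field_simp
  rw [ecos, eG, h1]
  field_simp

theorem isLittleO_fouCov {α lam H A : ℝ} (hα : 1 / 2 < α) (hα' : α < 3 / 2) (hlam : 0 < lam)
    (hH : H = α - 1 / 2) (hA : A = -1 / (2 * Real.Gamma (2 * α) * Real.cos (α * Real.pi))) :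
    (fun τ : ℝ => fouCov α lam τ - (fouCov α lam 0 - A * |τ| ^ (2 * H)))
      =o[𝓝 0] fun τ : ℝ => |τ| ^ (2 * H) := by
  have hν : 0 < α - 1 / 2 := by linarith
  rw [neg_one_div_gamma_mul_cos hα hα'] at hA
  have ht := (tendsto_heatIncrement lam hν (by linarith)).const_mul
    (1 / (2 * √Real.pi * Real.Gamma α) * (4 ^ (α - 1 / 2))⁻¹)
  rw [← hA] at ht
  have ht' := (ht.const_sub A)
  rw [sub_self] at ht'
  have h := ((isBigO_refl (fun τ : ℝ => |τ| ^ (2 * H)) (𝓝 0)).mul_isLittleO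
    ((isLittleO_one_iff ℝ).2 ht'))
  simp only [mul_one] at h
  refine h.congr_left fun τ => ?_
  have e1 := heatIntegral_zero_sub τ hν hlam
  have e2 : (τ ^ 2 / 4) ^ (α - 1 / 2) = |τ| ^ (2 * H) * (4 ^ (α - 1 / 2))⁻¹ := by
    rw [Real.div_rpow (by positivity) (by norm_num), ← sq_abs, ← Real.rpow_natCast,
      ← Real.rpow_mul (abs_nonneg τ), hH, div_eq_mul_inv]
    norm_num
  rw [e2] at e1
  rw [fouCov_eq_heatIntegral hα hlam, fouCov_eq_heatIntegral hα hlam]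
  linear_combination (1 / (2 * √Real.pi * Real.Gamma α)) * e1

theorem abs_add_rpow_le {κ : ℝ} (hκ : 0 ≤ κ) (a b : ℝ) :
    |a + b| ^ κ ≤ 2 ^ κ * (|a| ^ κ + |b| ^ κ) := by
  have key : ∀ a b : ℝ, |a| ≤ |b| → |a + b| ^ κ ≤ 2 ^ κ * (|a| ^ κ + |b| ^ κ) := by
    intro a b h
    have h1 : |a + b| ≤ 2 * |b| := (abs_add_le a b).trans (by linarith)
    calc |a + b| ^ κ ≤ (2 * |b|) ^ κ := Real.rpow_le_rpow (abs_nonneg _) h1 hκ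
      _ = 2 ^ κ * |b| ^ κ := Real.mul_rpow two_pos.le (abs_nonneg _)
      _ ≤ _ := by
        gcongr
        exact le_add_of_nonneg_left (by positivity)
  rcases le_total |a| |b| with h | h
  · exact key a b h
  · rw [add_comm a, add_comm (|a| ^ κ)]
    exact key b a h

theorem tfbmCov_add_sub_mean (α lam t τ : ℝ) :
    tfbmCov α lam t (t + τ) - (tfbmCov α lam t t + tfbmCov α lam (t + τ) (t + τ)) / 2
      = fouCov α lam τ - fouCov α lam 0 := by
  simp only [tfbmCov, sub_self, sub_add_cancel_left, fouCov_neg]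
  ring

/-- The arguments `t`, `τ` and `t + τ` are those at which the error term of the expansion of
`fouCov` enters the TFBM covariance. -/
theorem isLittleO_prod_of_isLittleO_abs_rpow {R : ℝ → ℝ} {κ : ℝ} (hκ : 0 ≤ κ)
    (hR : R =o[𝓝 0] fun τ : ℝ => |τ| ^ κ) :
    ((fun p : ℝ × ℝ => R p.1) =o[𝓝 (0, 0)] fun p : ℝ × ℝ => |p.1| ^ κ + |p.2| ^ κ) ∧
    ((fun p : ℝ × ℝ => R p.2) =o[𝓝 (0, 0)] fun p : ℝ × ℝ => |p.1| ^ κ + |p.2| ^ κ) ∧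
    ((fun p : ℝ × ℝ => R (p.1 + p.2)) =o[𝓝 (0, 0)]
      fun p : ℝ × ℝ => |p.1| ^ κ + |p.2| ^ κ) := by
  have t1 : Tendsto (fun p : ℝ × ℝ => p.1) (𝓝 (0, 0)) (𝓝 0) := continuous_fst.tendsto _
  have t2 : Tendsto (fun p : ℝ × ℝ => p.2) (𝓝 (0, 0)) (𝓝 0) := continuous_snd.tendsto _
  have t3 : Tendsto (fun p : ℝ × ℝ => p.1 + p.2) (𝓝 (0, 0)) (𝓝 0) := by
    simpa using t1.add t2
  refine ⟨(hR.comp_tendsto t1).trans_isBigO (IsBigO.of_bound 1 (Eventually.of_forall fun p => ?_)),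
    (hR.comp_tendsto t2).trans_isBigO (IsBigO.of_bound 1 (Eventually.of_forall fun p => ?_)),
    (hR.comp_tendsto t3).trans_isBigO
      (IsBigO.of_bound (2 ^ κ) (Eventually.of_forall fun p => ?_))⟩
  all_goals
    have h1 : 0 ≤ |p.1| ^ κ := by positivity
    have h2 : 0 ≤ |p.2| ^ κ := by positivity
    simp only [Function.comp]
    rw [Real.norm_of_nonneg (by positivity), Real.norm_of_nonneg (by positivity)]
  · linarith
  · linarith
  · exact abs_add_rpow_le hκ _ _

theorem isLittleO_tfbmCov {α lam A κ : ℝ} (hκ : 0 ≤ κ)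
    (h : (fun τ : ℝ => fouCov α lam τ - (fouCov α lam 0 - A * |τ| ^ κ))
      =o[𝓝 0] fun τ : ℝ => |τ| ^ κ) :
    (fun p : ℝ × ℝ => tfbmCov α lam p.1 (p.1 + p.2)
        - A * (|p.1 + p.2| ^ κ + |p.1| ^ κ - |p.2| ^ κ))
      =o[𝓝 (0, 0)] fun p : ℝ × ℝ => |p.1| ^ κ + |p.2| ^ κ := by
  obtain ⟨h1, h2, h3⟩ := isLittleO_prod_of_isLittleO_abs_rpow hκ h
  refine ((h2.sub h1).sub h3).congr_left fun p => ?_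
  simp only [tfbmCov, sub_add_cancel_left, fouCov_neg]
  ring

theorem isLittleO_tfbmCov_mean {α lam A κ : ℝ} (hκ : 0 ≤ κ)
    (h : (fun τ : ℝ => fouCov α lam τ - (fouCov α lam 0 - A * |τ| ^ κ))
      =o[𝓝 0] fun τ : ℝ => |τ| ^ κ) :
    (fun p : ℝ × ℝ =>
        (tfbmCov α lam (p.1 + p.2) (p.1 + p.2) + tfbmCov α lam p.1 p.1) / 2
        - A * (|p.1 + p.2| ^ κ + |p.1| ^ κ))
      =o[𝓝 (0, 0)] fun p : ℝ × ℝ => |p.1| ^ κ + |p.2| ^ κ := by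
  obtain ⟨h1, _, h3⟩ := isLittleO_prod_of_isLittleO_abs_rpow hκ h
  refine (h1.neg_left.sub h3).congr_left fun p => ?_
  simp only [tfbmCov, sub_self]
  ring

/-- The covariance of the rescaled increments converges to that of fractional Brownian motion. -/
theorem tendsto_tfbmCov_div {α lam A H : ℝ}
    (h : (fun τ : ℝ => fouCov α lam τ - (fouCov α lam 0 - A * |τ| ^ (2 * H)))
      =o[𝓝 0] fun τ : ℝ => |τ| ^ (2 * H)) (u v : ℝ) :
    Tendsto (fun ε : ℝ => tfbmCov α lam (ε * u) (ε * v) / (ε ^ H * ε ^ H)) (𝓝[>] 0)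
      (𝓝 (A * (|u| ^ (2 * H) + |v| ^ (2 * H) - |u - v| ^ (2 * H)))) := by
  have key : ∀ w : ℝ, Tendsto (fun ε : ℝ => (fouCov α lam 0 - fouCov α lam (ε * w))
      / (ε ^ H * ε ^ H)) (𝓝[>] 0) (𝓝 (A * |w| ^ (2 * H))) := by
    intro w
    have t : Tendsto (fun ε : ℝ => ε * w) (𝓝[>] 0) (𝓝 0) := by
      have : Tendsto (fun ε : ℝ => ε * w) (𝓝 0) (𝓝 (0 * w)) := tendsto_id.mul_const w
      rw [zero_mul] at this
      exact this.mono_left nhdsWithin_le_nhds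
    have hpow : ∀ ε : ℝ, 0 < ε → |ε * w| ^ (2 * H) = |w| ^ (2 * H) * (ε ^ H * ε ^ H) := by
      intro ε hε
      rw [abs_mul, Real.mul_rpow (abs_nonneg _) (abs_nonneg _), abs_of_pos hε, two_mul,
        Real.rpow_add hε]
      ring
    have hb : (fun ε : ℝ => |ε * w| ^ (2 * H)) =O[𝓝[>] 0] fun ε : ℝ => ε ^ H * ε ^ H := by
      refine IsBigO.of_bound (|w| ^ (2 * H)) ?_
      filter_upwards [self_mem_nhdsWithin] with ε hε
      have hε : 0 < ε := hε
      rw [hpow ε hε, Real.norm_of_nonneg (by positivity), Real.norm_of_nonneg (by positivity)]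
    have hl := ((h.comp_tendsto t).trans_isBigO hb).tendsto_div_nhds_zero
    have hl' := hl.const_sub (A * |w| ^ (2 * H))
    rw [sub_zero] at hl'
    refine hl'.congr' ?_
    filter_upwards [self_mem_nhdsWithin] with ε hε
    have hε : 0 < ε := hε
    have : 0 < ε ^ H := by positivity
    simp only [Function.comp, hpow ε hε]
    field_simp
    ring
  have := ((key u).add (key v)).sub (key (u - v))
  rw [show A * |u| ^ (2 * H) + A * |v| ^ (2 * H) - A * |u - v| ^ (2 * H)
    = A * (|u| ^ (2 * H) + |v| ^ (2 * H) - |u - v| ^ (2 * H)) by ring] at this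
  refine this.congr fun ε => ?_
  rw [← add_div, ← sub_div, mul_sub, tfbmCov]
  congr 1
  ring

/-! ### Weak convergence of centred Gaussian vectors -/

theorem charFun_map_toLp_of_integral_eq_zero {ι Ω : Type*} [Fintype ι] [MeasurableSpace Ω]
    {P : Measure Ω} {X : ι → Ω → ℝ} (hX : HasGaussianLaw (fun ω i => X i ω) P)
    (h0 : ∀ i, ∫ ω, X i ω ∂P = 0) (t : EuclideanSpace ℝ ι) :
    charFun (P.map fun ω => WithLp.toLp 2 fun i => X i ω) t
      = Complex.exp (-((∑ i, ∑ j, t i * t j * ∫ ω, X i ω * X j ω ∂P : ℝ) : ℂ) / 2) := by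
  have hm : ∀ i, MemLp (X i) 2 P := fun i => (hX.eval i).memLp_two
  have hi : ∀ i, Integrable (X i) P := fun i => (hX.eval i).integrable
  have e1 : ∀ ω, inner ℝ t (WithLp.toLp 2 fun i => X i ω) = ∑ i, t i * X i ω := by
    intro ω
    simp [PiLp.inner_apply, mul_comm]
  have e2 : ∫ ω, ∑ i, t i * X i ω ∂P = 0 := by
    rw [integral_finsetSum _ fun i _ => (hi i).const_mul _]
    simp [integral_const_mul, h0]
  have e3 : Var[fun ω => ∑ i, t i * X i ω; P]
      = ∑ i, ∑ j, t i * t j * ∫ ω, X i ω * X j ω ∂P := by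
    rw [variance_of_integral_eq_zero _ e2]
    · have : ∀ ω, (∑ i, t i * X i ω) ^ 2 = ∑ i, ∑ j, t i * t j * (X i ω * X j ω) := by
        intro ω
        rw [sq, Finset.sum_mul_sum]
        refine Finset.sum_congr rfl fun i _ => Finset.sum_congr rfl fun j _ => by ring
      simp_rw [this]
      have hij : ∀ i j, Integrable (fun ω => t i * t j * (X i ω * X j ω)) P :=
        fun i j => ((hm i).integrable_mul (hm j)).const_mul _
      rw [integral_finsetSum _ fun i _ => integrable_finsetSum _ fun j _ => hij i j]
      refine Finset.sum_congr rfl fun i _ => ?_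
      rw [integral_finsetSum _ fun j _ => hij i j]
      simp_rw [integral_const_mul]
    · exact Finset.aemeasurable_fun_sum _ fun i _ => (hi i).aemeasurable.const_mul _
  rw [(hX.toLp_pi 2).charFun_map_eq]
  simp_rw [e1]
  rw [e2, e3]
  congr 1
  push_cast
  ring

/-- A centred Gaussian law is determined by its covariances, continuously: this is Lévy's
continuity theorem applied to the explicit characteristic functions. -/
theorem tendstoInDistribution_of_tendsto_covariance {ι κ Ω Ω' : Type*} [Fintype ι]
    [MeasurableSpace Ω] [MeasurableSpace Ω'] {P : Measure Ω} {P' : Measure Ω'}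
    [IsProbabilityMeasure P] [IsProbabilityMeasure P'] {l : Filter κ} [l.IsCountablyGenerated]
    {X : κ → ι → Ω → ℝ} {Y : ι → Ω' → ℝ}
    (hX : ∀ n, HasGaussianLaw (fun ω i => X n i ω) P) (hY : HasGaussianLaw (fun ω i => Y i ω) P')
    (hX0 : ∀ n i, ∫ ω, X n i ω ∂P = 0) (hY0 : ∀ i, ∫ ω, Y i ω ∂P' = 0)
    (h : ∀ i j, Tendsto (fun n => ∫ ω, X n i ω * X n j ω ∂P) l
      (𝓝 (∫ ω, Y i ω * Y j ω ∂P'))) :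
    TendstoInDistribution (fun n ω i => X n i ω) l (fun ω i => Y i ω) (fun _ => P) P' := by
  -- Characteristic functions need an inner product, which the sup-normed `ι → ℝ` lacks.
  have key : TendstoInDistribution (fun n ω => WithLp.toLp 2 fun i => X n i ω) l
      (fun ω => WithLp.toLp 2 fun i => Y i ω) (fun _ => P) P' := by
    refine ⟨fun n => ((hX n).toLp_pi 2).aemeasurable, (hY.toLp_pi 2).aemeasurable, ?_⟩
    -- Lévy's theorem is available for sequences only.
    refine tendsto_of_seq_tendsto fun x hx => ?_
    refine ProbabilityMeasure.tendsto_of_tendsto_charFun fun t => ?_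
    simp only [Function.comp, ProbabilityMeasure.coe_mk]
    rw [charFun_map_toLp_of_integral_eq_zero hY hY0]
    simp_rw [fun n => charFun_map_toLp_of_integral_eq_zero (hX n) (hX0 n) t]
    refine (Complex.continuous_exp.tendsto _).comp (Tendsto.div_const (Tendsto.neg ?_) _)
    refine (Complex.continuous_ofReal.tendsto _).comp ?_
    exact tendsto_finsetSum _ fun i _ => tendsto_finsetSum _ fun j _ =>
      ((h i j).comp hx).const_mul _
  exact key.continuous_comp (g := WithLp.ofLp) (PiLp.continuous_ofLp 2 _)

/-! ### Fractional Brownian motion from white noise -/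

/-- The integral `∫_0^∞ (1 - cos (w x)) x^(-2H-1) dx`. -/
noncomputable def oneSubCosIntegral (H w : ℝ) : ℝ :=
  ∫ x in Set.Ioi (0 : ℝ), (1 - Real.cos (w * x)) * x ^ (-(2 * H) - 1)

theorem integrableOn_one_sub_cos {H : ℝ} (hH : 0 < H) (hH' : H < 1) (w : ℝ) :
    IntegrableOn (fun x : ℝ => (1 - Real.cos (w * x)) * x ^ (-(2 * H) - 1)) (Set.Ioi 0) := by
  refine integrableOn_Ioi_of_le_rpow (a := 1 - 2 * H) (b := -(2 * H) - 1) (C := w ^ 2 / 2 + 2)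
    (by linarith) (by linarith) (by fun_prop) (fun x hx _ => ?_) (fun x hx => ?_)
  · have h1 := Real.cos_le_one (w * x)
    have h2 := Real.one_sub_sq_div_two_le_cos (x := w * x)
    have h3 : x ^ (1 - 2 * H) = x ^ 2 * x ^ (-(2 * H) - 1) := by
      rw [← Real.rpow_natCast, ← Real.rpow_add hx]
      congr 1
      push_cast
      ring
    rw [abs_of_nonneg (mul_nonneg (by linarith) (by positivity)), h3, ← mul_assoc]
    gcongr
    nlinarith [sq_nonneg x]
  · have hx0 : 0 < x := by linarith
    have h1 := Real.cos_le_one (w * x)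
    have h2 := Real.neg_one_le_cos (w * x)
    rw [abs_of_nonneg (mul_nonneg (by linarith) (by positivity))]
    gcongr
    nlinarith [sq_nonneg w]

/-- By scaling, the value of the integral at `w = 1` is a mere normalising constant. -/
theorem oneSubCosIntegral_eq {H : ℝ} (hH : 0 < H) (w : ℝ) :
    oneSubCosIntegral H w = |w| ^ (2 * H) * oneSubCosIntegral H 1 := by
  rcases eq_or_ne w 0 with rfl | hw
  · rw [abs_zero, Real.zero_rpow (by positivity)]
    simp [oneSubCosIntegral]
  have hw' : 0 < |w| := abs_pos.2 hw
  have h := integral_comp_mul_left_Ioi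
    (fun x : ℝ => (1 - Real.cos (1 * x)) * x ^ (-(2 * H) - 1)) 0 hw'
  rw [mul_zero, smul_eq_mul] at h
  unfold oneSubCosIntegral
  rw [eq_inv_mul_iff_mul_eq₀ hw'.ne'] at h
  rw [← h, ← integral_const_mul, ← integral_const_mul]
  refine setIntegral_congr_fun measurableSet_Ioi fun x hx => ?_
  have hx : 0 < x := hx
  have hc : Real.cos (1 * (|w| * x)) = Real.cos (w * x) := by
    rw [one_mul, ← Real.cos_abs (w * x), abs_mul, abs_of_pos hx]
  have hp : |w| ^ (2 * H) * (|w| * |w| ^ (-(2 * H) - 1)) = 1 := by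
    rw [Real.rpow_sub_one hw'.ne', Real.rpow_neg hw'.le]
    have : 0 < |w| ^ (2 * H) := by positivity
    field_simp
  simp only [hc]
  rw [Real.mul_rpow hw'.le hx.le]
  linear_combination (-(1 - Real.cos (w * x)) * x ^ (-(2 * H) - 1)) * hp

theorem oneSubCosIntegral_one_pos {H : ℝ} (hH : 0 < H) (hH' : H < 1) :
    0 < oneSubCosIntegral H 1 := by
  unfold oneSubCosIntegral
  rw [setIntegral_pos_iff_support_of_nonneg_ae _ (integrableOn_one_sub_cos hH hH' 1)]
  · refine lt_of_lt_of_le (b := volume (Set.Ioo (0 : ℝ) 1)) (by simp) (measure_mono ?_)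
    intro x hx
    refine ⟨?_, hx.1⟩
    have hx0 : 0 < x := hx.1
    have hc : Real.cos x < 1 := by
      rw [← Real.cos_zero]
      exact Real.cos_lt_cos_of_nonneg_of_le_pi le_rfl (by linarith [hx.2, Real.pi_gt_three]) hx0
    have : 0 < x ^ (-(2 * H) - 1) := by positivity
    rw [Function.mem_support, one_mul]
    exact (mul_pos (by linarith) this).ne'
  · refine ae_restrict_of_forall_mem measurableSet_Ioi fun x hx => ?_
    have hx : 0 < x := hx
    have := Real.cos_le_one (1 * x)
    exact mul_nonneg (by linarith) (by positivity)

/-- The real form of the spectral kernel `x ↦ (exp (i u x) - 1) |x|^(-H-1/2)` of fractional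
Brownian motion: its real part sits on the positive half-line, and its imaginary part on the
negative one. -/
noncomputable def spectralKernel (H u x : ℝ) : ℝ :=
  (if 0 < x then 1 - Real.cos (u * x) else Real.sin (u * x)) * |x| ^ (-H - 1 / 2)

theorem measurable_spectralKernel (H u : ℝ) : Measurable (spectralKernel H u) := by
  unfold spectralKernel
  refine Measurable.mul (Measurable.ite measurableSet_Ioi ?_ ?_) ?_ <;> fun_prop

theorem rpow_mul_self_spectral (H : ℝ) {x : ℝ} (hx : 0 < x) :
    x ^ (-H - 1 / 2) * x ^ (-H - 1 / 2) = x ^ (-(2 * H) - 1) := by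
  rw [← Real.rpow_add hx]; ring_nf

theorem memLp_spectralKernel {H : ℝ} (hH : 0 < H) (hH' : H < 1) (u : ℝ) :
    MemLp (spectralKernel H u) 2 (volume : Measure ℝ) := by
  have hm := measurable_spectralKernel H u
  rw [memLp_two_iff_integrable_sq hm.aestronglyMeasurable, ← integrableOn_univ,
    ← Set.Iic_union_Ioi (a := (0 : ℝ)), integrableOn_union]
  have hi := (integrableOn_one_sub_cos hH hH' u).const_mul 2
  have pos : IntegrableOn (fun x => spectralKernel H u x ^ 2) (Set.Ioi 0) := by
    refine Integrable.mono' hi (hm.pow_const 2).aestronglyMeasurable ?_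
    refine ae_restrict_of_forall_mem measurableSet_Ioi fun x hx => ?_
    have hx : 0 < x := hx
    have h1 := Real.cos_le_one (u * x)
    have h2 := Real.neg_one_le_cos (u * x)
    rw [Real.norm_of_nonneg (by positivity), spectralKernel, if_pos hx, abs_of_pos hx, mul_pow,
      sq (x ^ _), rpow_mul_self_spectral H hx, ← mul_assoc]
    gcongr
    nlinarith
  have neg : IntegrableOn (fun x => spectralKernel H u (-x) ^ 2) (Set.Ioi 0) := by
    refine Integrable.mono' hi
      ((hm.comp measurable_neg).pow_const 2).aestronglyMeasurable ?_
    refine ae_restrict_of_forall_mem measurableSet_Ioi fun x hx => ?_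
    have hx : 0 < x := hx
    have h1 := Real.cos_le_one (u * x)
    have h2 := Real.neg_one_le_cos (u * x)
    have h3 := Real.sin_sq_add_cos_sq (u * x)
    rw [Real.norm_of_nonneg (by positivity), spectralKernel, if_neg (by linarith), abs_neg,
      abs_of_pos hx, mul_pow, sq (x ^ _), rpow_mul_self_spectral H hx, ← mul_assoc, mul_neg,
      Real.sin_neg, neg_sq]
    gcongr
    nlinarith
  refine ⟨?_, pos⟩
  have := neg.comp_neg
  simp only [neg_neg, Set.neg_Ioi, neg_zero] at this
  rwa [integrableOn_Iic_iff_integrableOn_Iio]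

/-- This is `(1 - cos a) (1 - cos b) + sin a sin b = (1 - cos a) + (1 - cos b) - (1 - cos (a - b))`,
integrated. -/
theorem integral_spectralKernel_mul {H : ℝ} (hH : 0 < H) (hH' : H < 1) (u v : ℝ) :
    ∫ x, spectralKernel H u x * spectralKernel H v x
      = oneSubCosIntegral H 1 * (|u| ^ (2 * H) + |v| ^ (2 * H) - |u - v| ^ (2 * H)) := by
  have hi : Integrable (fun x => spectralKernel H u x * spectralKernel H v x) :=
    (memLp_spectralKernel hH hH' u).integrable_mul (memLp_spectralKernel hH hH' v)
  have hneg : ∫ x in Set.Iic (0 : ℝ), spectralKernel H u x * spectralKernel H v x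
      = ∫ x in Set.Ioi (0 : ℝ), spectralKernel H u (-x) * spectralKernel H v (-x) := by
    rw [integral_comp_neg_Ioi 0 fun x => spectralKernel H u x * spectralKernel H v x, neg_zero]
  have hi' : IntegrableOn (fun x => spectralKernel H u (-x) * spectralKernel H v (-x))
      (Set.Ioi 0) := hi.comp_neg.integrableOn
  have hI := integrableOn_one_sub_cos hH hH'
  have hS : IntegrableOn (fun x : ℝ => (1 - Real.cos (u * x)) * x ^ (-(2 * H) - 1)
      + (1 - Real.cos (v * x)) * x ^ (-(2 * H) - 1)) (Set.Ioi 0) := (hI u).add (hI v)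
  have hR : oneSubCosIntegral H 1 * (|u| ^ (2 * H) + |v| ^ (2 * H) - |u - v| ^ (2 * H))
      = oneSubCosIntegral H u + oneSubCosIntegral H v - oneSubCosIntegral H (u - v) := by
    rw [oneSubCosIntegral_eq hH u, oneSubCosIntegral_eq hH v, oneSubCosIntegral_eq hH (u - v)]
    ring
  rw [← integral_add_compl measurableSet_Iic hi, Set.compl_Iic, hneg,
    ← integral_add hi' hi.integrableOn, hR]
  simp only [oneSubCosIntegral]
  rw [← integral_add (hI u) (hI v), ← integral_sub hS (hI (u - v))]
  refine setIntegral_congr_fun measurableSet_Ioi fun x hx => ?_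
  have hx : 0 < x := hx
  have hn : ¬ 0 < -x := by linarith
  simp only [spectralKernel, hx, hn, if_true, if_false, abs_neg, abs_of_pos hx, mul_neg,
    Real.sin_neg, ← rpow_mul_self_spectral H hx, sub_mul u v x, Real.cos_sub]
  ring

/-- White noise on any probability space carries a fractional Brownian motion of each Hurst index
and each variance. -/
theorem exists_isFBM {Ω : Type*} [MeasurableSpace Ω] {P : Measure Ω}
    {W : Lp ℝ 2 (volume : Measure ℝ) → Ω → ℝ} (hW : IsWhiteNoise W P) {H V : ℝ} (hH : 0 < H)
    (hH' : H < 1) (hV : 0 ≤ V) : ∃ T : ℝ → Ω → ℝ, IsFBM H V T P := by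
  have hI := oneSubCosIntegral_one_pos hH hH'
  set c : ℝ := √(V / (2 * oneSubCosIntegral H 1))
  have hcc : c * c = V / (2 * oneSubCosIntegral H 1) := Real.mul_self_sqrt (by positivity)
  have hf : ∀ u, MemLp (fun x => c * spectralKernel H u x) 2 (volume : Measure ℝ) :=
    fun u => (memLp_spectralKernel hH hH' u).const_mul c
  have e : (fun u => wienerIntegral W fun x => c * spectralKernel H u x)
      = W ∘ fun u => (hf u).toLp _ := by
    ext u ω
    simp [wienerIntegral, hf u]
  refine ⟨fun u => wienerIntegral W fun x => c * spectralKernel H u x, ?_, fun u => ?_,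
    fun u v => ?_⟩
  · rw [e]
    exact hW.gaussian.comp_right _
  · simp only [wienerIntegral, hf u, dif_pos]
    exact hW.centred _
  · rw [integral_wienerIntegral_mul hW (hf u) (hf v)]
    have : ∀ x, c * spectralKernel H u x * (c * spectralKernel H v x)
        = c * c * (spectralKernel H u x * spectralKernel H v x) := fun x => by ring
    simp_rw [this]
    rw [integral_const_mul, integral_spectralKernel_mul hH hH', hcc]
    field_simp

/-! ### The tangent process -/

/-- FOU and TFBM have the same increments, hence the same tangent processes. -/
theorem isTangentProcess_of_increments_eq_fou {Ω Ω' : Type*} [MeasurableSpace Ω]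
    [MeasurableSpace Ω'] {P : Measure Ω} [IsProbabilityMeasure P] {P' : Measure Ω'}
    [IsProbabilityMeasure P'] {W : Lp ℝ 2 (volume : Measure ℝ) → Ω → ℝ}
    (hW : IsWhiteNoise W P) {α lam H A : ℝ} (hα : 1 / 2 < α) (hlam : 0 < lam) (hH : 0 < H)
    (hA : 0 < A)
    (h : (fun τ : ℝ => fouCov α lam τ - (fouCov α lam 0 - A * |τ| ^ (2 * H)))
      =o[𝓝 0] fun τ : ℝ => |τ| ^ (2 * H))
    {Z : ℝ → Ω → ℝ} (hZ : ∀ t s ω, Z t ω - Z s ω = fou W α lam t ω - fou W α lam s ω)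
    {T : ℝ → Ω' → ℝ} (hT : IsFBM H (2 * A) T P') (t₀ : ℝ) :
    IsTangentProcess Z P H t₀ T P' := by
  have hX := isGaussianProcess_fou hW hα hlam
  have hXi : ∀ t, Integrable (fou W α lam t) P := fun t => (hX.hasGaussianLaw_eval t).integrable
  refine ⟨⟨1, fun h1 => ?_⟩, fun I => ?_⟩
  · have h2 := hT.covariance 1 1
    have h3 : ∫ ω, T 1 ω * T 1 ω ∂P' = 0 := by
      rw [integral_eq_zero_of_ae]
      filter_upwards [h1] with ω hω
      simp [hω]
    rw [h3, sub_self, abs_one, abs_zero, Real.one_rpow, Real.zero_rpow (by positivity)] at h2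
    linarith
  · -- The rescaled increments are linear images of the Gaussian process `fou`.
    have hG : ∀ ε : ℝ, IsGaussianProcess
        (fun u ω => (Z (t₀ + ε * u) ω - Z t₀ ω) / ε ^ H) P := by
      intro ε
      have := ((hX.shift t₀).comp_right fun u => ε * u).smul fun _ => (ε ^ H)⁻¹
      refine this.congr fun u => Eventually.of_forall fun ω => ?_
      simp only [Function.comp, smul_eq_mul, hZ]
      ring
    refine tendstoInDistribution_of_tendsto_covariance
      (X := fun ε (i : I) ω => (Z (t₀ + ε * i) ω - Z t₀ ω) / ε ^ H) (Y := fun (i : I) ω => T i ω)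
      (fun ε => (hG ε).hasGaussianLaw I) (hT.gaussian.hasGaussianLaw I) (fun ε i => ?_)
      (fun i => hT.centred i) (fun i j => ?_)
    · simp only [hZ]
      rw [integral_div, integral_sub (hXi _) (hXi _), integral_fou hW hα hlam,
        integral_fou hW hα hlam]
      simp
    · have hlim := tendsto_tfbmCov_div h (i : ℝ) (j : ℝ)
      rw [hT.covariance, mul_div_cancel_left₀ _ two_ne_zero]
      refine hlim.congr fun ε => ?_
      simp only [hZ, div_mul_div_comm]
      rw [integral_div, integral_fou_sub_mul_sub hW hα hlam, add_sub_cancel_left,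
        add_sub_cancel_left]

theorem mainTheorem4 {Ω : Type*} [MeasurableSpace Ω] (P : Measure Ω) [IsProbabilityMeasure P]
    (W : Lp ℝ 2 (volume : Measure ℝ) → Ω → ℝ) (hW : IsWhiteNoise W P)
    (α lam H A : ℝ) (hα : 1 / 2 < α) (hα' : α < 3 / 2) (hlam : 0 < lam)
    (hH : H = α - 1 / 2) (hA : A = -1 / (2 * Real.Gamma (2 * α) * Real.cos (α * Real.pi))) :
    -- the covariances of FOU and TFBM
    (∀ t s, ∫ ω, fou W α lam t ω * fou W α lam s ω ∂P = fouCov α lam (t - s)) ∧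
    (∀ t s, ∫ ω, tfbm W α lam t ω * tfbm W α lam s ω ∂P = tfbmCov α lam t s) ∧
    -- the second form of the constant
    (H ≠ 1 / 2 →
      A = Real.Gamma (1 - 2 * H) * Real.cos (H * Real.pi) / (2 * H * Real.pi)) ∧
    -- local self-similarity of FOU and of TFBM, of order `2H = 2α - 1`
    IsLocallySelfSimilarStationary (fouCov α lam) (2 * H) A ∧
    IsLocallySelfSimilar (tfbmCov α lam) (2 * H) A ∧
    -- the small time behaviour of the TFBM covariance and of the mean of the two variances
    ((fun p : ℝ × ℝ => tfbmCov α lam p.1 (p.1 + p.2)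
        - A * (|p.1 + p.2| ^ (2 * H) + |p.1| ^ (2 * H) - |p.2| ^ (2 * H)))
      =o[𝓝 (0, 0)] fun p : ℝ × ℝ => |p.1| ^ (2 * H) + |p.2| ^ (2 * H)) ∧
    ((fun p : ℝ × ℝ =>
        (tfbmCov α lam (p.1 + p.2) (p.1 + p.2) + tfbmCov α lam p.1 p.1) / 2
        - A * (|p.1 + p.2| ^ (2 * H) + |p.1| ^ (2 * H)))
      =o[𝓝 (0, 0)] fun p : ℝ × ℝ => |p.1| ^ (2 * H) + |p.2| ^ (2 * H)) ∧
    -- the tangent process of FOU and of TFBM at every point is FBM with Hurst index `H`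
    (∃ T : ℝ → Ω → ℝ, IsFBM H (2 * A) T P ∧
      (∀ t₀, IsTangentProcess (fou W α lam) P H t₀ T P) ∧
      (∀ t₀, IsTangentProcess (tfbm W α lam) P H t₀ T P)) := by
  have hH0 : 0 < H := by linarith
  have hH1 : H < 1 := by linarith
  have hApos : 0 < A := hA ▸ neg_one_div_gamma_mul_cos_pos hα hα'
  have hloc := isLittleO_fouCov hα hα' hlam hH hA
  refine ⟨integral_fou_mul hW hα hlam, fun t s => ?_, fun hne => ?_,
    ⟨by linarith, by linarith, hApos, hloc⟩, ⟨by linarith, by linarith, hApos, fun t => ?_⟩,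
    isLittleO_tfbmCov (by linarith) hloc, isLittleO_tfbmCov_mean (by linarith) hloc, ?_⟩
  · simpa [tfbm] using integral_fou_sub_mul_sub hW hα hlam t s 0
  · rw [hA, neg_one_div_gamma_mul_cos_eq_of_ne_half hα hα' hH hne]
  · refine hloc.congr_left fun τ => ?_
    linear_combination -tfbmCov_add_sub_mean α lam t τ
  · obtain ⟨T, hT⟩ := exists_isFBM hW hH0 hH1 (V := 2 * A) (by linarith)
    exact ⟨T, hT,
      isTangentProcess_of_increments_eq_fou hW hα hlam hH0 hApos hloc (fun _ _ _ => rfl) hT,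
      isTangentProcess_of_increments_eq_fou hW hα hlam hH0 hApos hloc
        (fun t s ω => by simp [tfbm]) hT⟩
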